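/- Let $\mathcal P=\mathbb C[x]$. A linear functional $\mathbf u:\mathcal P\to\mathbb C$ is *positive-definite* if $\langle\mathbf u,p\rangle>0$ for every nonzero $p\in\mathcal P$ with $p(x)\ge 0$ for all $x\in\mathbb R$. A sequence $\{P_n\}_{n\ge0}$ of monic polynomials with $\deg P_n=n$ is the *monic orthogonal polynomial sequence* (monic OPS) with respect to $\mathbf u$ if $\langle\mathbf u,P_mP_n\rangle=h_n\delta_{m,n}$ with $h_n\ne0$ for all $m,n\ge 0$. A *distribution function* is a bounded nondecreasing function $\psi:\mathbb R\to\mathbb R$ all of whose moments $\int_{-\infty}^{+\infty}x^n\,d\psi(x)$, $n\ge0$ (improper Riemann–Stieltjes integrals), are finite; its *spectrum* is $\sigma(\psi)=\{x\in\mathbb R:\psi(x+\delta)-\psi(x-\delta)>0\ \ \forall\delta>0\}$. For a positive-definite $\mathbf u$ with monic OPS $\{P_n\}$, let $x_{n,1}<\dots<x_{n,n}$ be the zeros of $P_n$ (real and simple) and $A_{n,1},\dots,A_{n,n}>0$ the weights of the Gauss quadrature formula, i.e. $\langle\mathbf u,p\rangle=\sum_{j=1}^nA_{n,j}\,p(x_{n,j})$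 for all $p$ of degree at most $2n-1$, and let $\psi_n(x)=\sum_{j:\,x_{n,j}\le x}A_{n,j}$. A function $\psi:\mathbb R\to\mathbb R$ that is the pointwise limit on $\mathbb R$ of some subsequence of $\{\psi_n\}$ is called a *natural representative* of $\mathbf u$ (the existence of such zeros and weights is part of what is asserted below). **Theorem.** (1) Let $\mathbf u$ be positive-definite. Then there is a natural representative $\psi$ of $\mathbf u$ which is a distribution function, whose spectrum is an infinite set, and such that $$\langle\mathbf u,p\rangle=\int_{-\infty}^{+\infty}p(x)\,d\psi(x)\qquad\text{for all }p\in\mathcal P .$$ (2) Let $\{P_n\}_{n\ge0}$ be the monic polynomials defined by $$P_{n+1}(x)=(x-\beta_n)P_n(x)-\gamma_nP_{n-1}(x),\quad n\ge0,\qquad P_{-1}=0,\ P_0=1,$$ where $\beta_n\in\mathbb R$ for $n\ge0$ and $\gamma_n>0$ for $n\ge1$. Then there is a positive Borel measure $\mu$ on $\mathbb R$, whose support is an infinite set and with $\int_{\mathbb R}|x|^n\,d\mu<\infty$ for all $n\ge0$, such that $$\int_{\mathbb R}P_n(x)P_m(x)\,d\mu(x)=\gamma_1\gamma_2\cdots\gamma_n\,\delta_{n,m},\qquad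 n,m\ge0$$ (the empty product being $1$). Moreover, $\mu$ can be chosen to be given by a natural representative: there are a positive-definite functional $\mathbf u$ with $\langle\mathbf u,1\rangle=1$ whose monic OPS is $\{P_n\}$ and a natural representative $\psi$ of $\mathbf u$ such that $\mu((-\infty,x])=\lim_{t\to x^+}\psi(t)$ for all $x\in\mathbb R$. -/

import Mathlib

open Polynomial MeasureTheory Filter Topology
open scoped ComplexOrder

/-- A linear functional on complex polynomials is positive-definite if it is positive on every
nonzero polynomial that takes only nonnegative real values on the real line.  (In the order of `ℂ`,
`0 ≤ z` means that `z` is real and nonnegative, `0 < z` that it is real and positive.) -/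
def IsPositiveDefinite (u : ℂ[X] →ₗ[ℂ] ℂ) : Prop :=
  ∀ p : ℂ[X], p ≠ 0 → (∀ x : ℝ, 0 ≤ p.eval (x : ℂ)) → 0 < u p

/-- `P` is the monic orthogonal polynomial sequence with respect to `u`. -/
def IsMonicOPS (u : ℂ[X] →ₗ[ℂ] ℂ) (P : ℕ → ℂ[X]) : Prop :=
  (∀ n, (P n).Monic ∧ (P n).natDegree = n) ∧
    ∃ h : ℕ → ℂ, (∀ n, h n ≠ 0) ∧ ∀ m n, u (P m * P n) = if m = n then h n else 0

/-- `x 0 < ⋯ < x (n - 1)` and `A 0, …, A (n - 1) > 0` are the nodes and weights of the `n`-point Gauss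
quadrature formula for `u`: the nodes are the zeros of the polynomial `p` (the member of degree `n`
of the monic orthogonal polynomial sequence), which are real and simple, and the formula is exact
on polynomials of degree at most `2 n - 1`. -/
structure IsGaussQuadrature (u : ℂ[X] →ₗ[ℂ] ℂ) (p : ℂ[X]) (n : ℕ) (x A : Fin n → ℝ) : Prop where
  strictMono : StrictMono x
  zeros : p = ∏ j, (X - C ((x j : ℝ) : ℂ))
  pos : ∀ j, 0 < A j
  exact : ∀ q : ℂ[X], q.degree < ((2 * n : ℕ) : WithBot ℕ) →
    u q = ∑ j, (A j : ℂ) * q.eval ((x j : ℝ) : ℂ)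

/-- The right-continuous step function that vanishes near `-∞` and has the jump `A j` at `x j`. -/
noncomputable def stepFunction {n : ℕ} (x A : Fin n → ℝ) (t : ℝ) : ℝ :=
  ∑ j, if x j ≤ t then A j else 0

/-- `ψ` is a natural representative of `u`: the pointwise limit on `ℝ` of a subsequence of the
step functions `ψ_n` given by the zeros of `P_n` and the weights of Gauss quadrature. -/
def IsNaturalRepresentative (u : ℂ[X] →ₗ[ℂ] ℂ) (ψ : ℝ → ℝ) : Prop :=
  ∃ (P : ℕ → ℂ[X]) (x A : (n : ℕ) → Fin n → ℝ) (φ : ℕ → ℕ),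
    IsMonicOPS u P ∧ (∀ n, IsGaussQuadrature u (P n) n (x n) (A n)) ∧ StrictMono φ ∧
      ∀ t : ℝ, Tendsto (fun j => stepFunction (x (φ j)) (A (φ j)) t) atTop (𝓝 (ψ t))

/-- The Riemann–Stieltjes integral `∫_a^b f dψ` exists and equals `I`: the Riemann–Stieltjes sums
over tagged partitions of `[a, b]` converge to `I` as the mesh tends to zero. -/
def HasRSIntegralOn {E : Type*} [NormedAddCommGroup E] [NormedSpace ℝ E]
    (f : ℝ → E) (ψ : ℝ → ℝ) (a b : ℝ) (I : E) : Prop :=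
  ∀ ε > 0, ∃ δ > 0, ∀ (m : ℕ) (t ξ : ℕ → ℝ), t 0 = a → t m = b →
    (∀ i < m, t i ≤ ξ i ∧ ξ i ≤ t (i + 1)) → (∀ i < m, t (i + 1) - t i < δ) →
      ‖∑ i ∈ Finset.range m, (ψ (t (i + 1)) - ψ (t i)) • f (ξ i) - I‖ < ε

/-- The improper Riemann–Stieltjes integral `∫_{-∞}^{+∞} f dψ` exists and equals `I`: the integrals
over `[a, b]` exist and tend to `I` as `a → -∞` and `b → +∞` independently. -/
def HasRSIntegral {E : Type*} [NormedAddCommGroup E] [NormedSpace ℝ E]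
    (f : ℝ → E) (ψ : ℝ → ℝ) (I : E) : Prop :=
  ∃ F : ℝ → ℝ → E, (∀ a b, a ≤ b → HasRSIntegralOn f ψ a b (F a b)) ∧
    Tendsto (fun p : ℝ × ℝ => F p.1 p.2) (atBot ×ˢ atTop) (𝓝 I)

/-- A distribution function: bounded, nondecreasing, with finite moments of all orders. -/
structure IsDistributionFunction (ψ : ℝ → ℝ) : Prop where
  bounded : ∃ K : ℝ, ∀ x, |ψ x| ≤ K
  monotone : Monotone ψ
  moments : ∀ n : ℕ, ∃ s : ℝ, HasRSIntegral (fun x : ℝ => x ^ n) ψ s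

/-- The spectrum of a distribution function: the set of its points of increase. -/
def distributionSpectrum (ψ : ℝ → ℝ) : Set ℝ :=
  {x | ∀ δ > 0, 0 < ψ (x + δ) - ψ (x - δ)}

/-! Everything is moved to Lebesgue measure on the fixed interval `(0, s)`, with `s = u 1` the total
mass: a Stieltjes integral of `f` against `ψ` becomes the ordinary integral of `f ∘ quantile ψ`, and
the measure sought is the image of Lebesgue measure under `quantile ψ`.

For a positive-definite functional, orthogonality forces the zeros of `P_n` to be real and simple,
and `exists_gauss` gives the quadrature. Helly's theorem extracts a pointwise limit `ψ` of the step
functions. The second moment is fixed, so no mass escapes to infinity and `ψ` has total mass `s`.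
The quantiles converge almost everywhere. By exactness on `p ^ 2`, the integrals of `p ^ 2` along
the sequence are all `L (p ^ 2)`; this gives uniform integrability, so the integrals of `p` converge
(Vitali), and they all equal `L p` already.

Finitely many points cannot carry the mass: the square of the polynomial vanishing on them would
integrate to zero. Favard's part defines a functional by `L P_0 = 1` and `L P_n = 0` for `n > 0`;
the recurrence gives orthogonality, `γ_n > 0` gives positivity, and the first part applies. -/

/-! ### Mass functions, quantiles and the associated measure. -/

/-- A nondecreasing function with limits `0` at `-∞` and `s` at `+∞`. -/
structure IsMassFunction (s : ℝ) (ψ : ℝ → ℝ) : Prop where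
  monotone : Monotone ψ
  tendsto_atBot : Tendsto ψ atBot (𝓝 0)
  tendsto_atTop : Tendsto ψ atTop (𝓝 s)

/-- The generalized inverse of a nondecreasing function. -/
noncomputable def quantile (ψ : ℝ → ℝ) (y : ℝ) : ℝ := sInf {x | y ≤ ψ x}

/-- The measure on `ℝ` of which `ψ` is a cumulative distribution function. -/
noncomputable def quantileMeasure (s : ℝ) (ψ : ℝ → ℝ) : Measure ℝ :=
  (volume.restrict (Set.Ioo 0 s)).map (quantile ψ)

namespace IsMassFunction

variable {s : ℝ} {ψ : ℝ → ℝ}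

theorem nonneg (h : IsMassFunction s ψ) (x : ℝ) : 0 ≤ ψ x :=
  h.monotone.le_of_tendsto h.tendsto_atBot x

theorem le (h : IsMassFunction s ψ) (x : ℝ) : ψ x ≤ s :=
  h.monotone.ge_of_tendsto h.tendsto_atTop x

/-- Positivity of `y` bounds the set in the infimum from below, so `sInf` is not a default value. -/
theorem quantile_le (h : IsMassFunction s ψ) {x y : ℝ} (hy : 0 < y) (hx : y ≤ ψ x) :
    quantile ψ y ≤ x := by
  refine csInf_le ?_ hx
  obtain ⟨z, hz⟩ := (h.tendsto_atBot.eventually (gt_mem_nhds hy)).exists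
  exact ⟨z, fun w hw => le_of_not_gt fun hwz => (hw.trans (h.monotone hwz.le)).not_gt hz⟩

/-- Nonemptiness is assumed through `z` rather than through `y < s`, so that `y = s` is allowed when
`ψ` attains `s`. -/
theorem le_quantile_of_le (h : IsMassFunction s ψ) {x y z : ℝ} (hz : y ≤ ψ z) (hx : ψ x < y) :
    x ≤ quantile ψ y :=
  le_csInf ⟨z, hz⟩ fun _ hw => le_of_not_gt fun hwx => (hw.trans (h.monotone hwx.le)).not_gt hx

theorem le_quantile (h : IsMassFunction s ψ) {x y : ℝ} (hy : y < s) (hx : ψ x < y) :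
    x ≤ quantile ψ y := by
  obtain ⟨z, hz⟩ := (h.tendsto_atTop.eventually (lt_mem_nhds hy)).exists
  exact h.le_quantile_of_le hz.le hx

theorem lt_of_lt_quantile (h : IsMassFunction s ψ) {x y : ℝ} (hy : 0 < y)
    (hx : x < quantile ψ y) : ψ x < y :=
  lt_of_not_ge fun hc => (h.quantile_le hy hc).not_gt hx

theorem le_of_quantile_lt (h : IsMassFunction s ψ) {x y : ℝ} (hy : y < s)
    (hx : quantile ψ y < x) : y ≤ ψ x :=
  le_of_not_gt fun hc => (h.le_quantile hy hc).not_gt hx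

theorem monotoneOn_quantile (h : IsMassFunction s ψ) :
    MonotoneOn (quantile ψ) (Set.Ioo 0 s) := fun _ hy _ hz hyz =>
  le_of_forall_gt_imp_ge_of_dense fun _ hc =>
    h.quantile_le hy.1 (hyz.trans (h.le_of_quantile_lt hz.2 hc))

theorem aemeasurable_quantile (h : IsMassFunction s ψ) :
    AEMeasurable (quantile ψ) (volume.restrict (Set.Ioo 0 s)) :=
  aemeasurable_restrict_of_monotoneOn measurableSet_Ioo h.monotoneOn_quantile

theorem quantile_mem_spectrum (h : IsMassFunction s ψ) {y : ℝ} (hy : y ∈ Set.Ioo 0 s) :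
    quantile ψ y ∈ distributionSpectrum ψ := fun δ hδ => by
  have h1 := h.le_of_quantile_lt hy.2 (lt_add_of_pos_right (quantile ψ y) hδ)
  have h2 := h.lt_of_lt_quantile hy.1 (sub_lt_self (quantile ψ y) hδ)
  linarith

theorem isFiniteMeasure (s : ℝ) (ψ : ℝ → ℝ) : IsFiniteMeasure (quantileMeasure s ψ) := by
  unfold quantileMeasure; infer_instance

theorem quantileMeasure_Iic (h : IsMassFunction s ψ) (x : ℝ) :
    quantileMeasure s ψ (Set.Iic x) = volume (quantile ψ ⁻¹' Set.Iic x ∩ Set.Ioo 0 s) := by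
  rw [quantileMeasure, Measure.map_apply_of_aemeasurable h.aemeasurable_quantile measurableSet_Iic,
    Measure.restrict_apply' measurableSet_Ioo]

theorem le_quantileMeasure_Iic (h : IsMassFunction s ψ) (x : ℝ) :
    ψ x ≤ (quantileMeasure s ψ).real (Set.Iic x) := by
  have := isFiniteMeasure s ψ
  rw [measureReal_def, ← ENNReal.ofReal_le_iff_le_toReal (measure_ne_top _ _),
    h.quantileMeasure_Iic]
  calc ENNReal.ofReal (ψ x) = volume (Set.Ioo 0 (ψ x)) := by simp
    _ ≤ volume (quantile ψ ⁻¹' Set.Iic x ∩ Set.Ioo 0 s) := measure_mono fun y hy =>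
      ⟨h.quantile_le hy.1 hy.2.le, hy.1, hy.2.trans_le (h.le x)⟩

/-- The strict inequality is needed because `ψ` may fail to be right-continuous at `x`. -/
theorem quantileMeasure_Iic_le (h : IsMassFunction s ψ) {x z : ℝ} (hxz : x < z) :
    (quantileMeasure s ψ).real (Set.Iic x) ≤ ψ z := by
  refine ENNReal.toReal_le_of_le_ofReal (h.nonneg z) ?_
  rw [h.quantileMeasure_Iic]
  calc _ ≤ volume (Set.Ioc 0 (ψ z)) := measure_mono fun y hy =>
        ⟨hy.2.1, h.le_of_quantile_lt hy.2.2 (lt_of_le_of_lt hy.1 hxz)⟩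
    _ = _ := by simp

theorem tendsto_nhdsGT (h : IsMassFunction s ψ) (x : ℝ) :
    Tendsto ψ (𝓝[>] x) (𝓝 ((quantileMeasure s ψ).real (Set.Iic x))) := by
  have := isFiniteMeasure s ψ
  have hc : Tendsto (fun z => (quantileMeasure s ψ).real (Set.Iic z)) (𝓝[>] x)
      (𝓝 ((quantileMeasure s ψ).real (Set.Iic x))) := by
    refine (ENNReal.tendsto_toReal (measure_ne_top _ _)).comp ?_
    have h2 := tendsto_measure_biInter_gt (μ := quantileMeasure s ψ) (s := Set.Iic) (a := x)
      (fun r _ => measurableSet_Iic.nullMeasurableSet) (fun i j _ hij => Set.Iic_subset_Iic.2 hij)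
      ⟨x + 1, by simp, measure_ne_top _ _⟩
    have hInter : ⋂ r > x, Set.Iic r = Set.Iic x := by
      ext y
      simp only [Set.mem_Iic, Set.mem_iInter]
      exact ⟨fun hy => le_of_forall_gt_imp_ge_of_dense hy, fun hy r hr => hy.trans (le_of_lt hr)⟩
    rwa [hInter] at h2
  exact tendsto_of_tendsto_of_tendsto_of_le_of_le' tendsto_const_nhds hc
    (eventually_mem_nhdsWithin.mono fun z hz => h.quantileMeasure_Iic_le hz)
    (Eventually.of_forall h.le_quantileMeasure_Iic)

theorem integral_quantileMeasure {E : Type*} [NormedAddCommGroup E] [NormedSpace ℝ E]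
    (h : IsMassFunction s ψ) {f : ℝ → E} (hf : Continuous f) :
    ∫ x, f x ∂quantileMeasure s ψ = ∫ y in Set.Ioo 0 s, f (quantile ψ y) :=
  integral_map h.aemeasurable_quantile hf.aestronglyMeasurable

/-- Pointwise convergence of mass functions implies almost everywhere convergence of quantiles. -/
theorem ae_tendsto_quantile {Ψ : ℕ → ℝ → ℝ} (hΨ : ∀ n, IsMassFunction s (Ψ n))
    (h : IsMassFunction s ψ) (hlim : ∀ x, Tendsto (fun n => Ψ n x) atTop (𝓝 (ψ x))) :
    ∀ᵐ y ∂volume.restrict (Set.Ioo 0 s),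
      Tendsto (fun n => quantile (Ψ n) y) atTop (𝓝 (quantile ψ y)) := by
  have hcount := h.monotoneOn_quantile.countable_not_continuousWithinAt
  filter_upwards [ae_restrict_mem measurableSet_Ioo,
    ae_restrict_of_ae (hcount.ae_notMem volume)] with y hy hcont
  replace hcont : ContinuousAt (quantile ψ) y := by
    simp only [not_and, not_not] at hcont
    exact (hcont hy).continuousAt (isOpen_Ioo.mem_nhds hy)
  refine tendsto_order.2 ⟨fun a ha => ?_, fun b hb => ?_⟩
  · obtain ⟨c, hac, hc⟩ := exists_between ha
    filter_upwards [(hlim c).eventually (gt_mem_nhds (h.lt_of_lt_quantile hy.1 hc))] with n hn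
    exact hac.trans_le ((hΨ n).le_quantile hy.2 hn)
  · obtain ⟨c, hc, hcb⟩ := exists_between hb
    -- A level `z` strictly above `y` yields the strict bound `y < ψ c`, which passes to `Ψ n c` for
    -- large `n`. Only this upper estimate needs continuity of the quantile at `y`.
    have hev : ∀ᶠ z in 𝓝[>] y, quantile ψ z < c ∧ z ∈ Set.Ioo 0 s :=
      nhdsWithin_le_nhds ((hcont.eventually (gt_mem_nhds hc)).and (isOpen_Ioo.mem_nhds hy))
    obtain ⟨z, ⟨hzc, hz⟩, hyz⟩ := (hev.and eventually_mem_nhdsWithin).exists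
    have : y < ψ c := lt_of_lt_of_le hyz (h.le_of_quantile_lt hz.2 hzc)
    filter_upwards [(hlim c).eventually (lt_mem_nhds this)] with n hn
    exact ((hΨ n).quantile_le hy.1 hn.le).trans_lt hcb

end IsMassFunction

/-! ### Riemann–Stieltjes integrals as integrals of quantiles. -/

/-- For `y` in `(ψ (t i), ψ (t (i + 1))]` the quantile lies in `[t i, t (i + 1)]`, so each term of
the sum differs from its piece of the integral by at most the oscillation of `f` times the increment
of `ψ`. -/
theorem IsMassFunction.hasRSIntegralOn {E : Type*} [NormedAddCommGroup E] [NormedSpace ℝ E]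
    [CompleteSpace E] {s : ℝ} {ψ : ℝ → ℝ} (h : IsMassFunction s ψ) {f : ℝ → E} (hf : Continuous f)
    (hint : IntervalIntegrable (fun y => f (quantile ψ y)) volume 0 s) (a b : ℝ) :
    HasRSIntegralOn f ψ a b (∫ y in (ψ a)..(ψ b), f (quantile ψ y)) := by
  intro ε hε
  have hs : 0 ≤ s := (h.nonneg 0).trans (h.le 0)
  have hmem (x : ℝ) : ψ x ∈ Set.uIcc 0 s := Set.uIcc_of_le hs ▸ ⟨h.nonneg x, h.le x⟩
  have hII (x y : ℝ) : IntervalIntegrable (fun y => f (quantile ψ y)) volume (ψ x) (ψ y) :=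
    hint.mono_set (Set.uIcc_subset_uIcc (hmem x) (hmem y))
  -- The increments of `ψ` add up to at most `s`; the `+ 1` covers `s = 0` and makes the final
  -- inequality strict.
  obtain ⟨δ, hδ, hδf⟩ := Metric.uniformContinuousOn_iff_le.1
    (isCompact_Icc.uniformContinuousOn_of_continuous (s := Set.Icc a b) hf.continuousOn)
    (ε / (s + 1)) (by positivity)
  refine ⟨δ, hδ, fun m t ξ h0 hm hξ hmesh => ?_⟩
  have hstep (i : ℕ) (hi : i < m) : t i ≤ t (i + 1) := (hξ i hi).1.trans (hξ i hi).2
  have hmono (i j : ℕ) (hij : i ≤ j) (hj : j ≤ m) : t i ≤ t j := by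
    induction j, hij using Nat.le_induction with
    | base => rfl
    | succ j _ ih => exact (ih (by lia)).trans (hstep j (by lia))
  have ht (i : ℕ) (hi : i ≤ m) : t i ∈ Set.Icc a b :=
    ⟨h0 ▸ hmono 0 i (by lia) hi, hm ▸ hmono i m hi le_rfl⟩
  have hpiece (i : ℕ) (hi : i < m) :
      ‖(ψ (t (i + 1)) - ψ (t i)) • f (ξ i) - ∫ y in (ψ (t i))..(ψ (t (i + 1))), f (quantile ψ y)‖
        ≤ ε / (s + 1) * (ψ (t (i + 1)) - ψ (t i)) := by
    have hle := h.monotone (hstep i hi)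
    rw [← intervalIntegral.integral_const, ← intervalIntegral.integral_sub (by simp) (hII _ _)]
    refine (intervalIntegral.norm_integral_le_of_norm_le_const fun y hy => ?_).trans_eq
      (by rw [abs_of_nonneg (sub_nonneg.2 hle)])
    rw [Set.uIoc_of_le hle] at hy
    have h1 := h.quantile_le ((h.nonneg _).trans_lt hy.1) hy.2
    have h2 := h.le_quantile_of_le hy.2 hy.1
    rw [← dist_eq_norm]
    have hti := ht i hi.le
    have hti' := ht (i + 1) hi
    have hξi := hξ i hi
    have hm := hmesh i hi
    exact hδf _ ⟨hti.1.trans hξi.1, hξi.2.trans hti'.2⟩ _ ⟨hti.1.trans h2, h1.trans hti'.2⟩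
      (by rw [Real.dist_eq, abs_le]; constructor <;> linarith)
  rw [← h0, ← hm, ← intervalIntegral.sum_integral_adjacent_intervals (a := fun i => ψ (t i))
    fun k _ => hII _ _, ← Finset.sum_sub_distrib]
  calc _ ≤ ∑ i ∈ Finset.range m, ε / (s + 1) * (ψ (t (i + 1)) - ψ (t i)) :=
        norm_sum_le_of_le _ fun i hi => hpiece i (Finset.mem_range.1 hi)
    _ = ε / (s + 1) * (ψ b - ψ a) := by
        rw [← Finset.mul_sum, Finset.sum_range_sub (fun i => ψ (t i)), h0, hm]
    _ ≤ ε / (s + 1) * s := by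
        have := h.nonneg a
        have := h.le b
        gcongr
        linarith
    _ < ε := by
        rw [div_mul_eq_mul_div, div_lt_iff₀ (by linarith)]
        linarith

/-- The primitive of `f ∘ quantile ψ` is continuous on `[0, s]`, and the end points `ψ a`, `ψ b`
tend to `0` and `s`. -/
theorem IsMassFunction.hasRSIntegral {E : Type*} [NormedAddCommGroup E] [NormedSpace ℝ E]
    [CompleteSpace E] {s : ℝ} {ψ : ℝ → ℝ} (h : IsMassFunction s ψ) {f : ℝ → E} (hf : Continuous f)
    (hint : IntegrableOn (fun y => f (quantile ψ y)) (Set.Ioo 0 s)) :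
    HasRSIntegral f ψ (∫ y in Set.Ioo 0 s, f (quantile ψ y)) := by
  have hs : 0 ≤ s := (h.nonneg 0).trans (h.le 0)
  have hII : IntervalIntegrable (fun y => f (quantile ψ y)) volume 0 s :=
    (intervalIntegrable_iff_integrableOn_Ioo_of_le hs).2 hint
  refine ⟨_, fun a b _ => h.hasRSIntegralOn hf hII a b, ?_⟩
  have hmem (x : ℝ) : ψ x ∈ Set.uIcc 0 s := Set.uIcc_of_le hs ▸ ⟨h.nonneg x, h.le x⟩
  have hc := intervalIntegral.continuousOn_primitive_interval' hII Set.left_mem_uIcc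
  have htop : Tendsto (fun b => ∫ y in (0)..(ψ b), f (quantile ψ y)) atTop
      (𝓝 (∫ y in (0)..s, f (quantile ψ y))) :=
    (hc s Set.right_mem_uIcc).tendsto.comp (tendsto_nhdsWithin_iff.2
      ⟨h.tendsto_atTop, Eventually.of_forall hmem⟩)
  have hbot : Tendsto (fun b => ∫ y in (0)..(ψ b), f (quantile ψ y)) atBot
      (𝓝 (∫ y in (0)..0, f (quantile ψ y))) :=
    (hc 0 Set.left_mem_uIcc).tendsto.comp (tendsto_nhdsWithin_iff.2
      ⟨h.tendsto_atBot, Eventually.of_forall hmem⟩)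
  have := (htop.comp (tendsto_snd (f := atBot))).sub (hbot.comp (tendsto_fst (g := atTop)))
  rw [intervalIntegral.integral_same, sub_zero, intervalIntegral.integral_of_le hs,
    integral_Ioc_eq_integral_Ioo] at this
  refine this.congr fun p => ?_
  exact intervalIntegral.integral_interval_sub_left
    (hII.mono_set (Set.uIcc_subset_uIcc Set.left_mem_uIcc (hmem _)))
    (hII.mono_set (Set.uIcc_subset_uIcc Set.left_mem_uIcc (hmem _)))

/-! ### Convergence of integrals and Helly selection. -/

/-- Almost everywhere convergence together with a uniform bound on the integrals of the squares
implies convergence of the integrals, on a finite measure space. -/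
theorem tendsto_integral_of_integral_sq_le {α : Type*} [MeasurableSpace α] {μ : Measure α}
    [IsFiniteMeasure μ] {g : ℕ → α → ℝ} {f : α → ℝ} {K : ℝ}
    (hg : ∀ n, AEStronglyMeasurable (g n) μ) (hsq : ∀ n, Integrable (fun x => g n x ^ 2) μ)
    (hK : ∀ n, ∫ x, g n x ^ 2 ∂μ ≤ K) (hlim : ∀ᵐ x ∂μ, Tendsto (fun n => g n x) atTop (𝓝 (f x))) :
    Integrable f μ ∧ Tendsto (fun n => ∫ x, g n x ∂μ) atTop (𝓝 (∫ x, f x ∂μ)) := by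
  have hK0 : 0 ≤ K := (integral_nonneg fun x => sq_nonneg (g 0 x)).trans (hK 0)
  have hui : UniformIntegrable g 1 μ := by
    refine uniformIntegrable_of le_rfl ENNReal.one_ne_top hg fun ε hε => ?_
    -- Where `|g n| ≥ R` one has `|g n| ≤ g n ^ 2 / R`, so the tail integral is at most `K / R`.
    obtain ⟨R, hR⟩ : ∃ R : NNReal, 0 < R ∧ K / R ≤ ε := by
      have h0 : 0 < K / ε + 1 := by positivity
      refine ⟨(K / ε + 1).toNNReal, Real.toNNReal_pos.2 h0, ?_⟩
      rw [Real.coe_toNNReal _ h0.le, div_le_iff₀ h0]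
      field_simp
      linarith
    refine ⟨R, fun n => ?_⟩
    rw [eLpNorm_one_eq_lintegral_enorm]
    calc _ ≤ ∫⁻ x, ENNReal.ofReal (g n x ^ 2 / R) ∂μ := by
          refine lintegral_mono fun x => ?_
          by_cases hx : R ≤ ‖g n x‖₊
          · rw [Set.indicator_of_mem (by simpa using hx), ← ofReal_norm, Real.norm_eq_abs]
            refine ENNReal.ofReal_le_ofReal ?_
            have hx' : (R : ℝ) ≤ |g n x| := by simpa using NNReal.coe_le_coe.2 hx
            rw [le_div_iff₀ (by exact_mod_cast hR.1), ← sq_abs, sq]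
            gcongr
          · rw [Set.indicator_of_notMem (by simpa using hx)]
            simp
      _ = ENNReal.ofReal (∫ x, g n x ^ 2 / R ∂μ) :=
          (ofReal_integral_eq_lintegral_ofReal ((hsq n).div_const _)
            (Eventually.of_forall fun x => by positivity)).symm
      _ ≤ _ := by
          refine ENNReal.ofReal_le_ofReal ?_
          rw [integral_div]
          exact (div_le_div_of_nonneg_right (hK n) R.2).trans hR.2
  have hf := hui.memLp_of_ae_tendsto hlim
  exact ⟨memLp_one_iff_integrable.1 hf, tendsto_integral_of_L1' f hf.1
    (Eventually.of_forall fun n => memLp_one_iff_integrable.1 (hui.memLp n))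
    (tendsto_Lp_finite_of_tendsto_ae le_rfl ENNReal.one_ne_top hg hf hui.unifIntegrable hlim)⟩

/-- A countable product of compact intervals is compact and first countable, hence sequentially
compact. -/
theorem exists_subseq_tendsto_of_countable {ι : Type*} [Countable ι] {s : ℝ} {Ψ : ℕ → ι → ℝ}
    (h : ∀ n x, Ψ n x ∈ Set.Icc 0 s) :
    ∃ φ : ℕ → ℕ, StrictMono φ ∧ ∃ ψ : ι → ℝ, ∀ x, Tendsto (fun j => Ψ (φ j) x) atTop (𝓝 (ψ x)) := by
  obtain ⟨ψ, φ, hφ, hlim⟩ := CompactSpace.tendsto_subseq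
    (fun n x => (⟨Ψ n x, h n x⟩ : Set.Icc (0 : ℝ) s))
  exact ⟨φ, hφ, fun x => ψ x, fun x =>
    (continuous_subtype_val.tendsto _).comp (tendsto_pi_nhds.1 hlim x)⟩

/-- **Helly's selection theorem**. -/
theorem exists_subseq_tendsto_of_monotone {s : ℝ} {Ψ : ℕ → ℝ → ℝ} (hmono : ∀ n, Monotone (Ψ n))
    (h : ∀ n x, Ψ n x ∈ Set.Icc 0 s) :
    ∃ φ : ℕ → ℕ, StrictMono φ ∧ ∃ ψ : ℝ → ℝ, ∀ x, Tendsto (fun j => Ψ (φ j) x) atTop (𝓝 (ψ x)) := by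
  obtain ⟨φ₁, hφ₁, g, hg⟩ := exists_subseq_tendsto_of_countable
    (Ψ := fun n (q : ℚ) => Ψ n q) fun n q => h n q
  -- The lower limit is monotone on all of `ℝ` and is the true limit at rationals, hence, by
  -- squeezing between rationals, also where it is continuous.
  set l : ℝ → ℝ := fun x => liminf (fun j => Ψ (φ₁ j) x) atTop with hl
  have hlmono : Monotone l := fun x y hxy =>
    liminf_le_liminf (Eventually.of_forall fun j => hmono _ hxy)
      (isBoundedUnder_of ⟨0, fun j => (h _ _).1⟩)
      (isBoundedUnder_of ⟨s, fun j => (h _ _).2⟩).isCoboundedUnder_ge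
  have hlg (q : ℚ) : Tendsto (fun j => Ψ (φ₁ j) q) atTop (𝓝 (l q)) := by
    rw [hl]; simp only [(hg q).liminf_eq]; exact hg q
  have hlim (x : ℝ) (hx : ContinuousAt l x) : Tendsto (fun j => Ψ (φ₁ j) x) atTop (𝓝 (l x)) := by
    refine tendsto_order.2 ⟨fun a ha => ?_, fun b hb => ?_⟩
    · obtain ⟨c, hc, hcx⟩ := exists_Ioc_subset_of_mem_nhds (hx.eventually (lt_mem_nhds ha))
        ⟨x - 1, by linarith⟩
      obtain ⟨q, hcq, hqx⟩ := exists_rat_btwn hc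
      filter_upwards [(hlg q).eventually (lt_mem_nhds (hcx ⟨hcq, hqx.le⟩))] with j hj
      exact hj.trans_le (hmono _ hqx.le)
    · obtain ⟨c, hc, hcx⟩ := exists_Ico_subset_of_mem_nhds (hx.eventually (gt_mem_nhds hb))
        ⟨x + 1, by linarith⟩
      obtain ⟨q, hxq, hqc⟩ := exists_rat_btwn hc
      filter_upwards [(hlg q).eventually (gt_mem_nhds (hcx ⟨hxq.le, hqc⟩))] with j hj
      exact (hmono _ hxq.le).trans_lt hj
  -- Convergence is wanted at every point, so a second extraction handles the countably many
  -- discontinuities of `l`.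
  have := hlmono.countable_not_continuousAt.to_subtype
  obtain ⟨φ₂, hφ₂, g₂, hg₂⟩ := exists_subseq_tendsto_of_countable
    (Ψ := fun n (x : {x | ¬ContinuousAt l x}) => Ψ (φ₁ n) x) fun n x => h _ _
  have hex (x : ℝ) : ∃ y, Tendsto (fun j => Ψ (φ₁ (φ₂ j)) x) atTop (𝓝 y) := by
    by_cases hx : ContinuousAt l x
    · exact ⟨l x, (hlim x hx).comp hφ₂.tendsto_atTop⟩
    · exact ⟨g₂ ⟨x, hx⟩, hg₂ ⟨x, hx⟩⟩
  choose ψ hψ using hex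
  exact ⟨φ₁ ∘ φ₂, hφ₁.comp hφ₂, ψ, hψ⟩

/-! ### Orthogonal polynomials and Gauss quadrature. -/

/-- `p` is the monic polynomial of degree `n` orthogonal, with respect to `L`, to all polynomials of
smaller degree. -/
structure IsMonicOrthogonal (L : ℝ[X] →ₗ[ℝ] ℝ) (n : ℕ) (p : ℝ[X]) : Prop where
  monic : p.Monic
  natDegree : p.natDegree = n
  orthogonal : ∀ q : ℝ[X], q.degree < n → L (p * q) = 0

section RealFunctional

variable {L : ℝ[X] →ₗ[ℝ] ℝ}

theorem Polynomial.degree_sub_C_mul_lt {e q : ℝ[X]} {m : ℕ} (he : e.Monic) (hem : e.natDegree = m)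
    (hq : q.degree < (m + 1 : ℕ)) : (q - C (q.coeff m) * e).degree < m := by
  rw [degree_lt_iff_coeff_zero] at hq ⊢
  intro k hk
  rw [coeff_sub, coeff_C_mul]
  rcases hk.eq_or_lt with rfl | hk
  · rw [← hem, he.coeff_natDegree, mul_one, sub_self]
  · rw [hq k hk, coeff_eq_zero_of_natDegree_lt (hem.trans_lt hk), mul_zero, sub_zero]

theorem exists_orthogonal_projection (hL : ∀ p : ℝ[X], p ≠ 0 → 0 < L (p * p)) (m : ℕ) (r : ℝ[X]) :
    ∃ t : ℝ[X], t.degree < m ∧ ∀ q : ℝ[X], q.degree < m → L ((r - t) * q) = 0 := by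
  induction m generalizing r with
  | zero =>
    refine ⟨0, by simp, fun q hq => ?_⟩
    have : q = 0 := by simpa using hq
    simp [this]
  | succ m ih =>
    obtain ⟨t₀, ht₀, ho₀⟩ := ih (X ^ m)
    set e : ℝ[X] := X ^ m - t₀ with he
    have hdeg : t₀.degree < (X ^ m : ℝ[X]).degree := by rwa [degree_X_pow]
    have hem : e.Monic := (monic_X_pow m).sub_of_left hdeg
    have hed : e.degree = m := by rw [he, degree_sub_eq_left_of_degree_lt hdeg, degree_X_pow]
    obtain ⟨t, ht, ho⟩ := ih r
    have hlt : (m : WithBot ℕ) < (m + 1 : ℕ) := by exact_mod_cast m.lt_succ_self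
    refine ⟨t + C (L (r * e) / L (e * e)) * e, ?_, fun q hq => ?_⟩
    · refine (degree_add_le _ _).trans_lt (max_lt (ht.trans hlt) ?_)
      rw [← smul_eq_C_mul]
      exact (degree_smul_le _ _).trans_lt (hed ▸ hlt)
    · have hq' := Polynomial.degree_sub_C_mul_lt hem (natDegree_eq_of_degree_eq_some hed) hq
      set c := q.coeff m
      set a := L (r * e) / L (e * e) with ha
      have h1 := ho _ hq'
      have h2 := ho₀ _ hq'
      have h3 := ho₀ _ ht
      have h4 : a * L (e * e) = L (r * e) := div_mul_cancel₀ _ (hL e hem.ne_zero).ne'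
      -- Gram–Schmidt: `q` is split as `(q - C c * e) + C c * e`. By `h1`, `h2`, `h3` only the terms
      -- in `r * e` and `e * e` survive, and `a` is chosen so that they cancel.
      have : (r - (t + C a * e)) * q = (r - t) * (q - C c * e) - a • (e * (q - C c * e))
          + c • (r * e) - c • (e * t) - (c * a) • (e * e) := by
        simp only [smul_eq_C_mul, C_mul]
        ring
      rw [this]
      simp only [map_add, map_sub, map_smul, smul_eq_mul]
      rw [h1, h2, h3, mul_assoc, h4]
      ring

theorem exists_isMonicOrthogonal (hL : ∀ p : ℝ[X], p ≠ 0 → 0 < L (p * p)) (n : ℕ) :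
    ∃ p, IsMonicOrthogonal L n p := by
  obtain ⟨t, ht, ho⟩ := exists_orthogonal_projection hL n (X ^ n)
  have hdeg : t.degree < (X ^ n : ℝ[X]).degree := by rwa [degree_X_pow]
  refine ⟨X ^ n - t, (monic_X_pow n).sub_of_left hdeg, natDegree_eq_of_degree_eq_some ?_, ho⟩
  rw [degree_sub_eq_left_of_degree_lt hdeg, degree_X_pow]

namespace IsMonicOrthogonal

variable {n : ℕ} {p : ℝ[X]}

theorem coeff_eq_one (hp : IsMonicOrthogonal L n p) : p.coeff n = 1 := by
  have h := hp.monic.coeff_natDegree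
  rwa [hp.natDegree] at h

/-- The source of real and simple zeros: a non-real pair or a double zero gives a factor `Q` for
which `Q * r * r` is a sum of squares, with `L`-value positive. -/
theorem apply_mul_eq_zero (hp : IsMonicOrthogonal L n p) {Q r : ℝ[X]} (h : p = Q * r)
    (hQ : Q.natDegree ≠ 0) : L (Q * r * r) = 0 := by
  have hr : r ≠ 0 := by rintro rfl; exact hp.monic.ne_zero (by simpa using h)
  have hQ0 : Q ≠ 0 := by rintro rfl; simp at hQ
  have hd := hp.natDegree
  rw [h, natDegree_mul hQ0 hr] at hd
  rw [← h]
  refine hp.orthogonal r ((natDegree_lt_iff_degree_lt hr).1 (by lia))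

theorem splits (hL : ∀ p : ℝ[X], p ≠ 0 → 0 < L (p * p)) (hp : IsMonicOrthogonal L n p) :
    p.Splits := by
  refine Splits.of_splits_map_of_injective (i := algebraMap ℝ ℂ) (algebraMap ℝ ℂ).injective
    (IsAlgClosed.splits _) fun z hz => ?_
  by_cases him : z.im = 0
  · exact ⟨z.re, Complex.ext (by simp) (by simp [him])⟩
  obtain ⟨r, hr⟩ := p.quadratic_dvd_of_aeval_eq_zero_im_ne_zero
    (by rw [aeval_def, eval₂_eq_eval_map]; exact isRoot_of_mem_roots hz) him
  have h0 := hp.apply_mul_eq_zero hr (by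
    have : (X ^ 2 - C (2 * z.re) * X + C (‖z‖ ^ 2) : ℝ[X]).natDegree = 2 := by compute_degree!
    lia)
  have hr0 : r ≠ 0 := by rintro rfl; exact hp.monic.ne_zero (by simpa using hr)
  have hsq : (X ^ 2 - C (2 * z.re) * X + C (‖z‖ ^ 2)) * r * r
      = ((X - C z.re) * r) * ((X - C z.re) * r) + (C z.im * r) * (C z.im * r) := by
    rw [← Complex.normSq_eq_norm_sq, Complex.normSq_apply]
    simp only [C_mul, C_add, map_ofNat]
    ring
  have h1 := hL _ (mul_ne_zero (X_sub_C_ne_zero z.re) hr0)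
  have h2 := hL _ (mul_ne_zero (C_ne_zero.2 him) hr0)
  rw [hsq, map_add] at h0
  linarith

theorem nodup_roots (hL : ∀ p : ℝ[X], p ≠ 0 → 0 < L (p * p)) (hp : IsMonicOrthogonal L n p) :
    p.roots.Nodup := by
  refine Multiset.nodup_iff_count_le_one.2 fun a => le_of_not_gt fun ha => ?_
  rw [count_roots] at ha
  obtain ⟨r, hr⟩ := (le_rootMultiplicity_iff hp.monic.ne_zero).1 (Nat.succ_le_of_lt ha)
  have h0 := hp.apply_mul_eq_zero hr (by simp [natDegree_pow])
  have hr0 : r ≠ 0 := by rintro rfl; exact hp.monic.ne_zero (by simpa using hr)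
  have h1 := hL _ (mul_ne_zero (X_sub_C_ne_zero a) hr0)
  rw [show (X - C a) ^ (Nat.succ 1) * r * r = ((X - C a) * r) * ((X - C a) * r) by ring] at h0
  exact h1.ne' h0

theorem exists_strictMono_nodes (hL : ∀ p : ℝ[X], p ≠ 0 → 0 < L (p * p))
    (hp : IsMonicOrthogonal L n p) :
    ∃ x : Fin n → ℝ, StrictMono x ∧ p = ∏ j, (X - C (x j)) := by
  have hs := hp.splits hL
  have hnd := hp.nodup_roots hL
  have hcard : p.roots.toFinset.card = n := by
    rw [Multiset.toFinset_card_of_nodup hnd, ← hs.natDegree_eq_card_roots, hp.natDegree]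
  refine ⟨p.roots.toFinset.orderEmbOfFin hcard, OrderEmbedding.strictMono _, ?_⟩
  rw [← Finset.prod_image (s := Finset.univ) (f := fun a => X - C a)
    (g := p.roots.toFinset.orderEmbOfFin hcard) (OrderEmbedding.strictMono _).injective.injOn,
    Finset.image_orderEmbOfFin_univ, Finset.prod, Multiset.toFinset_val, hnd.dedup]
  exact hs.eq_prod_roots_of_monic hp.monic

/-- The **Gauss quadrature formula**. -/
theorem exists_gauss (hL : ∀ p : ℝ[X], p ≠ 0 → 0 < L (p * p)) (hp : IsMonicOrthogonal L n p) :
    ∃ x A : Fin n → ℝ, StrictMono x ∧ p = ∏ j, (X - C (x j)) ∧ (∀ j, 0 < A j) ∧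
      ∀ q : ℝ[X], q.degree < (2 * n : ℕ) → L q = ∑ j, A j * q.eval (x j) := by
  obtain ⟨x, hx, hpx⟩ := hp.exists_strictMono_nodes hL
  have hinj : Set.InjOn x (Finset.univ : Finset (Fin n)) := hx.injective.injOn
  have hroot (j : Fin n) : p.eval (x j) = 0 := by
    rw [hpx, eval_prod, Finset.prod_eq_zero (Finset.mem_univ j) (by simp)]
  have hexact (q : ℝ[X]) (hq : q.degree < (2 * n : ℕ)) :
      L q = ∑ j, L (Lagrange.basis Finset.univ x j) * q.eval (x j) := by
    have hdiv := modByMonic_add_div q p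
    have hquot : (q /ₘ p).degree < n := by
      by_cases h0 : q /ₘ p = 0
      · rw [h0, degree_zero]; exact WithBot.bot_lt_coe _
      · have hq0 : q ≠ 0 := by rintro rfl; simp at h0
        have := (natDegree_lt_iff_degree_lt hq0).2 hq
        rw [← natDegree_lt_iff_degree_lt h0, natDegree_divByMonic q hp.monic, hp.natDegree]
        lia
    have hrem : (q %ₘ p).degree < n := by
      have := degree_modByMonic_lt q hp.monic
      rwa [degree_eq_natDegree hp.monic.ne_zero, hp.natDegree] at this
    have heval (j : Fin n) : q.eval (x j) = (q %ₘ p).eval (x j) := by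
      conv_lhs => rw [← hdiv]
      rw [eval_add, eval_mul, hroot, zero_mul, add_zero]
    have hLq : L q = L (q %ₘ p) := by
      conv_lhs => rw [← hdiv]
      rw [map_add, hp.orthogonal _ hquot, add_zero]
    rw [hLq, Lagrange.eq_interpolate (s := Finset.univ) (v := x) hinj (f := q %ₘ p) (by simpa),
      Lagrange.interpolate_apply, map_sum]
    refine Finset.sum_congr rfl fun j _ => ?_
    rw [← smul_eq_C_mul, map_smul, smul_eq_mul, mul_comm, heval]
  refine ⟨x, fun j => L (Lagrange.basis Finset.univ x j), hx, hpx, fun j => ?_, hexact⟩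
  -- The squared Lagrange basis polynomial has degree `2 * n - 2`, within the range of exactness,
  -- and quadrature evaluates it to the weight at node `j`.
  have hb0 := Lagrange.basis_ne_zero hinj (Finset.mem_univ j)
  have hpos := hL _ hb0
  rw [hexact _ ?_, Finset.sum_eq_single j] at hpos
  · simpa [Lagrange.eval_basis_self hinj (Finset.mem_univ j)] using hpos
  · intro i _ hij
    simp [Lagrange.eval_basis_of_ne hij.symm (Finset.mem_univ i)]
  · simp
  · have hd := Lagrange.natDegree_basis hinj (Finset.mem_univ j)
    rw [← natDegree_lt_iff_degree_lt (mul_ne_zero hb0 hb0), natDegree_mul hb0 hb0, hd]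
    have := j.pos
    simp only [Finset.card_univ, Fintype.card_fin]
    lia

end IsMonicOrthogonal

/-- Quadrature with `natDegree q + 1` nodes writes `L q` as a sum of nonnegative terms; if all
vanished, `q` would have more zeros than its degree. -/
theorem apply_pos_of_nonneg (hL : ∀ p : ℝ[X], p ≠ 0 → 0 < L (p * p)) {q : ℝ[X]} (hq : q ≠ 0)
    (hnonneg : ∀ x, 0 ≤ q.eval x) : 0 < L q := by
  obtain ⟨p, hp⟩ := exists_isMonicOrthogonal hL (q.natDegree + 1)
  obtain ⟨x, A, hx, -, hA, hG⟩ := hp.exists_gauss hL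
  rw [hG q ((natDegree_lt_iff_degree_lt hq).1 (by lia))]
  have hterm (j) : 0 ≤ A j * q.eval (x j) := mul_nonneg (hA j).le (hnonneg _)
  refine (Finset.sum_nonneg fun j _ => hterm j).lt_of_ne fun h0 => hq ?_
  rw [eq_comm, Finset.sum_eq_zero_iff_of_nonneg fun j _ => hterm j] at h0
  refine Polynomial.eq_zero_of_degree_lt_of_eval_index_eq_zero (s := Finset.univ) (v := x)
    hx.injective.injOn ((natDegree_lt_iff_degree_lt hq).1 (by simp)) fun j hj => ?_
  exact (mul_eq_zero.1 (h0 j hj)).resolve_left (hA j).ne'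

end RealFunctional

/-! ### Step functions of finitely many masses. -/

section StepFunction

variable {n : ℕ} {x A : Fin n → ℝ}

theorem stepFunction_monotone (hA : ∀ j, 0 < A j) : Monotone (stepFunction x A) := fun s t hst =>
  Finset.sum_le_sum fun j _ => by
    split_ifs with h1 h2
    · rfl
    · exact absurd (h1.trans hst) h2
    · exact (hA j).le
    · rfl

theorem stepFunction_isMassFunction (hA : ∀ j, 0 < A j) :
    IsMassFunction (∑ j, A j) (stepFunction x A) where
  monotone := stepFunction_monotone hA
  tendsto_atBot := by
    rw [← Finset.sum_const_zero (ι := Fin n) (s := Finset.univ)]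
    refine tendsto_finsetSum _ fun j _ => tendsto_const_nhds.congr' ?_
    filter_upwards [eventually_lt_atBot (x j)] with t ht
    rw [if_neg ht.not_ge]
  tendsto_atTop := by
    refine tendsto_finsetSum _ fun j _ => tendsto_const_nhds.congr' ?_
    filter_upwards [eventually_ge_atTop (x j)] with t ht
    rw [if_pos ht]

theorem stepFunction_tendsto_nhdsGT (t : ℝ) :
    Tendsto (stepFunction x A) (𝓝[>] t) (𝓝 (stepFunction x A t)) := by
  refine tendsto_finsetSum _ fun j _ => tendsto_const_nhds.congr' ?_
  by_cases h : x j ≤ t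
  · filter_upwards [self_mem_nhdsWithin] with r hr
    rw [if_pos h, if_pos (h.trans (le_of_lt hr))]
  · filter_upwards [nhdsWithin_le_nhds (gt_mem_nhds (not_le.1 h))] with r hr
    rw [if_neg h, if_neg hr.not_ge]

/-- Step functions are right-continuous, so both measures take the same values on the half-lines
`Iic t`. -/
theorem quantileMeasure_stepFunction (hA : ∀ j, 0 < A j) :
    quantileMeasure (∑ j, A j) (stepFunction x A)
      = ∑ j, ENNReal.ofReal (A j) • Measure.dirac (x j) := by
  have := IsMassFunction.isFiniteMeasure (∑ j, A j) (stepFunction x A)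
  refine Measure.ext_of_Iic _ _ fun t => ?_
  have h1 := tendsto_nhds_unique
    ((stepFunction_isMassFunction (x := x) hA).tendsto_nhdsGT t) (stepFunction_tendsto_nhdsGT t)
  rw [← ENNReal.ofReal_toReal (measure_ne_top (quantileMeasure _ _) _), ← measureReal_def, h1,
    stepFunction, ENNReal.ofReal_sum_of_nonneg (fun j _ => by split_ifs; exacts [(hA j).le, le_rfl]),
    Measure.finsetSum_apply]
  refine Finset.sum_congr rfl fun j _ => ?_
  by_cases h : x j ≤ t <;> simp [h]

theorem integrable_quantile_stepFunction (hA : ∀ j, 0 < A j) (f : ℝ → ℝ) :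
    IntegrableOn (fun y => f (quantile (stepFunction x A) y)) (Set.Ioo 0 (∑ j, A j)) := by
  have h : Integrable f (quantileMeasure (∑ j, A j) (stepFunction x A)) := by
    rw [quantileMeasure_stepFunction hA]
    exact integrable_finsetSum_measure.2 fun j _ =>
      (integrable_dirac (by simp)).smul_measure ENNReal.ofReal_ne_top
  exact h.comp_aemeasurable (stepFunction_isMassFunction hA).aemeasurable_quantile

theorem integral_quantile_stepFunction (hA : ∀ j, 0 < A j) {f : ℝ → ℝ} (hf : Continuous f) :
    ∫ y in Set.Ioo 0 (∑ j, A j), f (quantile (stepFunction x A) y) = ∑ j, A j * f (x j) := by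
  rw [← (stepFunction_isMassFunction hA).integral_quantileMeasure hf,
    quantileMeasure_stepFunction hA, integral_finsetSum_measure fun j _ =>
      (integrable_dirac (by simp)).smul_measure ENNReal.ofReal_ne_top]
  refine Finset.sum_congr rfl fun j _ => ?_
  rw [integral_smul_measure, integral_dirac, ENNReal.toReal_ofReal (hA j).le, smul_eq_mul]

/-- Chebyshev's inequality: with its right-hand counterpart it controls the mass near infinity by
the second moment. -/
theorem stepFunction_mul_sq_le (hA : ∀ j, 0 < A j) {t : ℝ} (ht : t < 0) :
    stepFunction x A t * t ^ 2 ≤ ∑ j, A j * x j ^ 2 := by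
  rw [stepFunction, Finset.sum_mul]
  refine Finset.sum_le_sum fun j _ => ?_
  have := hA j
  split_ifs with h
  · have : t ^ 2 ≤ x j ^ 2 := by nlinarith
    gcongr
  · rw [zero_mul]
    positivity

theorem sub_stepFunction_mul_sq_le (hA : ∀ j, 0 < A j) {t : ℝ} (ht : 0 < t) :
    (∑ j, A j - stepFunction x A t) * t ^ 2 ≤ ∑ j, A j * x j ^ 2 := by
  rw [stepFunction, ← Finset.sum_sub_distrib, Finset.sum_mul]
  refine Finset.sum_le_sum fun j _ => ?_
  have := hA j
  split_ifs with h
  · rw [sub_self, zero_mul]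
    positivity
  · have : t ^ 2 ≤ x j ^ 2 := by nlinarith
    rw [sub_zero]
    gcongr

end StepFunction

/-! ### Passage to the limit in Gauss quadrature. -/

theorem tendsto_const_div_sq {l : Filter ℝ} (K : ℝ) (hl : Tendsto (fun t : ℝ => t ^ 2) l atTop) :
    Tendsto (fun t => K / t ^ 2) l (𝓝 0) :=
  tendsto_const_nhds.div_atTop hl

/-- Some subsequence of the step functions of Gauss quadrature converges pointwise to a mass
function that represents the functional. -/
theorem exists_subseq_tendsto_stepFunction {L : ℝ[X] →ₗ[ℝ] ℝ} {x A : (n : ℕ) → Fin n → ℝ}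
    (hA : ∀ n j, 0 < A n j)
    (hG : ∀ n (q : ℝ[X]), q.degree < (2 * n : ℕ) → L q = ∑ j, A n j * q.eval (x n j)) :
    ∃ (φ : ℕ → ℕ) (ψ : ℝ → ℝ), StrictMono φ ∧
      (∀ t, Tendsto (fun j => stepFunction (x (φ j)) (A (φ j)) t) atTop (𝓝 (ψ t))) ∧
      IsMassFunction (L 1) ψ ∧
      ∀ p : ℝ[X], IntegrableOn (fun y => p.eval (quantile ψ y)) (Set.Ioo 0 (L 1)) ∧
        ∫ y in Set.Ioo 0 (L 1), p.eval (quantile ψ y) = L p := by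
  -- The shift by `2` makes every formula exact on `1` and `X ^ 2`.
  set Ψ : ℕ → ℝ → ℝ := fun n => stepFunction (x (n + 2)) (A (n + 2)) with hΨ
  have hsum (n : ℕ) : ∑ j, A (n + 2) j = L 1 := by
    rw [hG (n + 2) 1 (by rw [degree_one]; exact_mod_cast Nat.succ_pos _)]
    simp
  have hsq (n : ℕ) : ∑ j, A (n + 2) j * x (n + 2) j ^ 2 = L (X ^ 2) := by
    rw [hG (n + 2) (X ^ 2) (by rw [degree_X_pow]; exact_mod_cast (by lia : 2 < 2 * (n + 2)))]
    simp
  have hmass (n : ℕ) : IsMassFunction (L 1) (Ψ n) := hsum n ▸ stepFunction_isMassFunction (hA _)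
  obtain ⟨φ, hφ, ψ, hψ⟩ := exists_subseq_tendsto_of_monotone (fun n => (hmass n).monotone)
    fun n t => ⟨(hmass n).nonneg t, (hmass n).le t⟩
  have h : IsMassFunction (L 1) ψ := by
    refine ⟨fun s t hst => le_of_tendsto_of_tendsto' (hψ s) (hψ t) fun j =>
      (hmass _).monotone hst, ?_, ?_⟩
    · refine tendsto_of_tendsto_of_tendsto_of_le_of_le' tendsto_const_nhds
        (tendsto_const_div_sq (L (X ^ 2)) ?_) ?_ ?_
      · simpa [Function.comp_def] using
          (tendsto_pow_atTop two_ne_zero).comp (tendsto_neg_atBot_atTop (G := ℝ))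
      · exact Eventually.of_forall fun t => ge_of_tendsto' (hψ t) fun j => (hmass _).nonneg t
      · filter_upwards [eventually_lt_atBot 0] with t ht
        refine le_of_tendsto' (hψ t) fun j => ?_
        rw [le_div_iff₀ (sq_pos_of_neg ht), ← hsq (φ j)]
        exact stepFunction_mul_sq_le (hA _) ht
    · have h0 : Tendsto (fun t => L 1 - L (X ^ 2) / t ^ 2) atTop (𝓝 (L 1)) := by
        simpa using (tendsto_const_div_sq (L (X ^ 2)) (tendsto_pow_atTop two_ne_zero)).const_sub
          (L 1)
      refine tendsto_of_tendsto_of_tendsto_of_le_of_le' h0 tendsto_const_nhds ?_ ?_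
      · filter_upwards [eventually_gt_atTop 0] with t ht
        refine ge_of_tendsto' (hψ t) fun j => ?_
        rw [sub_le_comm, le_div_iff₀ (by positivity), ← hsq (φ j), ← hsum (φ j)]
        exact sub_stepFunction_mul_sq_le (hA _) ht
      · exact Eventually.of_forall fun t => le_of_tendsto' (hψ t) fun j => (hmass _).le t
  refine ⟨fun j => φ j + 2, ψ, hφ.add_const 2, hψ, h, fun p => ?_⟩
  have hint (n : ℕ) (q : ℝ[X]) (hq : q.natDegree < 2 * (n + 2)) :
      IntegrableOn (fun y => q.eval (quantile (Ψ n) y)) (Set.Ioo 0 (L 1)) ∧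
        ∫ y in Set.Ioo 0 (L 1), q.eval (quantile (Ψ n) y) = L q := by
    rw [hG (n + 2) q ((degree_le_natDegree).trans_lt (by exact_mod_cast hq)), ← hsum n]
    exact ⟨integrable_quantile_stepFunction (hA (n + 2)) fun t => q.eval t,
      integral_quantile_stepFunction (hA _) q.continuous⟩
  -- Starting the subsequence at index `p.natDegree` makes every formula exact on both `p` and `p ^
  -- 2`.
  have hd (j : ℕ) : p.natDegree ≤ φ (j + p.natDegree) :=
    (Nat.le_add_left _ _).trans (hφ.id_le _)
  have hd2 (j : ℕ) : (p ^ 2).natDegree < 2 * (φ (j + p.natDegree) + 2) := by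
    have := hd j
    rw [natDegree_pow]
    lia
  have hd1 (j : ℕ) : p.natDegree < 2 * (φ (j + p.natDegree) + 2) := by
    have := hd j
    lia
  have key := tendsto_integral_of_integral_sq_le
    (μ := volume.restrict (Set.Ioo 0 (L 1))) (f := fun y => p.eval (quantile ψ y)) (K := L (p ^ 2))
    (g := fun j y => p.eval (quantile (Ψ (φ (j + p.natDegree))) y))
    (fun j => (hint _ p (hd1 j)).1.aestronglyMeasurable)
    (fun j => by simpa only [eval_pow, IntegrableOn] using (hint _ (p ^ 2) (hd2 j)).1)
    (fun j => by simpa only [eval_pow] using (hint _ (p ^ 2) (hd2 j)).2.le) (by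
      filter_upwards [IsMassFunction.ae_tendsto_quantile (fun j => hmass (φ j)) h hψ] with y hy
      exact (p.continuous.tendsto _).comp (hy.comp (tendsto_add_atTop_nat p.natDegree)))
  refine ⟨key.1, tendsto_nhds_unique key.2 ?_⟩
  simp only [(hint _ p (hd1 _)).2]
  exact tendsto_const_nhds

/-! ### Passing between real and complex functionals. -/

section Complexification

theorem Polynomial.exists_eq_map_add_I_mul_map (p : ℂ[X]) :
    ∃ a b : ℝ[X], p = a.map Complex.ofRealHom + C Complex.I * b.map Complex.ofRealHom ∧
      a.degree ≤ p.degree ∧ b.degree ≤ p.degree := by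
  have hcoeff (f : ℂ → ℝ) (hf : f 0 = 0) (k : ℕ) :
      (∑ i ∈ p.support, monomial i (f (p.coeff i))).coeff k = f (p.coeff k) := by
    simp only [finsetSum_coeff, coeff_monomial, Finset.sum_ite_eq', mem_support_iff]
    split_ifs with h
    · rfl
    · rw [not_not.1 h, hf]
  have hdeg (f : ℂ → ℝ) (hf : f 0 = 0) :
      (∑ i ∈ p.support, monomial i (f (p.coeff i))).degree ≤ p.degree := by
    refine (degree_le_iff_coeff_zero _ _).2 fun k hk => ?_
    rw [hcoeff f hf, coeff_eq_zero_of_degree_lt hk, hf]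
  refine ⟨_, _, ?_, hdeg Complex.re rfl, hdeg Complex.im rfl⟩
  ext k : 1
  rw [coeff_add, coeff_C_mul, coeff_map, coeff_map, hcoeff _ rfl, hcoeff _ rfl]
  simp [mul_comm Complex.I, Complex.re_add_im]

theorem Polynomial.eval_map_ofReal (p : ℝ[X]) (x : ℝ) :
    (p.map Complex.ofRealHom).eval (x : ℂ) = ((p.eval x : ℝ) : ℂ) := by
  rw [← Complex.ofRealHom_eq_coe, eval_map_apply]; rfl

/-- `u` extends the real functional `L`. -/
def IsComplexification (u : ℂ[X] →ₗ[ℂ] ℂ) (L : ℝ[X] →ₗ[ℝ] ℝ) : Prop :=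
  ∀ p : ℝ[X], u (p.map Complex.ofRealHom) = L p

theorem exists_isComplexification (L : ℝ[X] →ₗ[ℝ] ℝ) :
    ∃ u : ℂ[X] →ₗ[ℂ] ℂ, IsComplexification u L := by
  refine ⟨(Polynomial.basisMonomials ℂ).constr ℂ fun k => (L (X ^ k) : ℂ), fun p => ?_⟩
  induction p using Polynomial.induction_on' with
  | add p q hp hq => rw [Polynomial.map_add, map_add, hp, hq, map_add, Complex.ofReal_add]
  | monomial n a =>
    have h1 : (monomial n (a : ℂ)) = (a : ℂ) • Polynomial.basisMonomials ℂ n := by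
      simp [smul_monomial]
    rw [map_monomial, Complex.ofRealHom_eq_coe, h1, map_smul, Module.Basis.constr_basis,
      ← mul_one a, ← smul_eq_mul a, ← smul_monomial, map_smul, monomial_one_right_eq_X_pow]
    simp

namespace IsComplexification

variable {u : ℂ[X] →ₗ[ℂ] ℂ} {L : ℝ[X] →ₗ[ℝ] ℝ}

theorem isPositiveDefinite (h : IsComplexification u L)
    (hL : ∀ p : ℝ[X], p ≠ 0 → 0 < L (p * p)) : IsPositiveDefinite u := by
  intro p hp0 hp
  obtain ⟨a, b, rfl, -, -⟩ := p.exists_eq_map_add_I_mul_map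
  simp only [eval_add, eval_mul, eval_C, eval_map_ofReal, Complex.le_def] at hp
  -- Nonnegative values are real, so the imaginary part `b` vanishes at every real point.
  have hb : b = 0 := Polynomial.funext fun x => by simpa using (hp x).2.symm
  subst hb
  simp only [Polynomial.map_zero, mul_zero, add_zero] at hp0 ⊢
  rw [h a]
  refine Complex.zero_lt_real.2 (apply_pos_of_nonneg hL ?_ fun x => by simpa using (hp x).1)
  rintro rfl
  simp at hp0

theorem isMonicOPS (h : IsComplexification u L) (hL : ∀ p : ℝ[X], p ≠ 0 → 0 < L (p * p))
    {p : ℕ → ℝ[X]} (hp : ∀ n, IsMonicOrthogonal L n (p n)) :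
    IsMonicOPS u fun n => (p n).map Complex.ofRealHom := by
  have hlt (m n : ℕ) (hmn : m < n) : L (p n * p m) = 0 := by
    refine (hp n).orthogonal _ ?_
    rw [← natDegree_lt_iff_degree_lt (hp m).monic.ne_zero, (hp m).natDegree]
    exact hmn
  refine ⟨fun n => ⟨(hp n).monic.map _, by rw [natDegree_map, (hp n).natDegree]⟩,
    fun n => L (p n * p n), fun n => ?_, fun m n => ?_⟩
  · exact Complex.ofReal_ne_zero.2 (hL _ (hp n).monic.ne_zero).ne'
  · rw [← Polynomial.map_mul, h]
    rcases lt_trichotomy m n with hmn | rfl | hmn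
    · rw [if_neg hmn.ne, mul_comm, hlt _ _ hmn, Complex.ofReal_zero]
    · rw [if_pos rfl]
    · rw [if_neg hmn.ne', hlt _ _ hmn, Complex.ofReal_zero]

theorem isGaussQuadrature (h : IsComplexification u L) {n : ℕ} {p : ℝ[X]} {x A : Fin n → ℝ}
    (hx : StrictMono x) (hp : p = ∏ j, (X - C (x j))) (hA : ∀ j, 0 < A j)
    (hG : ∀ q : ℝ[X], q.degree < (2 * n : ℕ) → L q = ∑ j, A j * q.eval (x j)) :
    IsGaussQuadrature u (p.map Complex.ofRealHom) n x A where
  strictMono := hx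
  zeros := by rw [hp, Polynomial.map_prod]; simp
  pos := hA
  exact q hq := by
    obtain ⟨a, b, hab, ha, hb⟩ := q.exists_eq_map_add_I_mul_map
    have h1 := hG a (ha.trans_lt hq)
    have h2 := hG b (hb.trans_lt hq)
    rw [hab, ← smul_eq_C_mul, map_add, map_smul, h, h, h1, h2]
    simp only [eval_add, eval_smul, eval_map_ofReal, mul_add, Finset.sum_add_distrib, smul_eq_mul,
      Complex.ofReal_sum, Complex.ofReal_mul, Finset.mul_sum]
    congr 1
    exact Finset.sum_congr rfl fun j _ => by ring

end IsComplexification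

theorem IsPositiveDefinite.exists_real {u : ℂ[X] →ₗ[ℂ] ℂ} (hu : IsPositiveDefinite u) :
    ∃ L : ℝ[X] →ₗ[ℝ] ℝ, IsComplexification u L ∧ ∀ p : ℝ[X], p ≠ 0 → 0 < L (p * p) := by
  have hpos (p : ℝ[X]) (hp : p ≠ 0) : 0 < u ((p * p).map Complex.ofRealHom) := by
    refine hu _ ?_ fun x => ?_
    · rw [Ne, Polynomial.map_eq_zero]
      exact mul_ne_zero hp hp
    · rw [eval_map_ofReal, eval_mul]
      exact Complex.zero_le_real.2 (mul_self_nonneg _)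
  have him (p : ℝ[X]) : (u ((p * p).map Complex.ofRealHom)).im = 0 := by
    by_cases hp : p = 0
    · simp [hp]
    · exact (Complex.lt_def.1 (hpos p hp)).2.symm
  let L : ℝ[X] →ₗ[ℝ] ℝ :=
    { toFun := fun p => (u (p.map Complex.ofRealHom)).re
      map_add' := fun p q => by simp
      map_smul' := fun a p => by
        rw [smul_eq_C_mul, Polynomial.map_mul, map_C, ← smul_eq_C_mul, map_smul]
        simp }
  refine ⟨L, fun p => Complex.ext rfl ?_, fun p hp => (Complex.lt_def.1 (hpos p hp)).1⟩
  -- Polarization: `4 p = (p + 1)² - (p - 1)²`, and `u` is already known to be real on squares.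
  have h4 : (p.map Complex.ofRealHom) = (4⁻¹ : ℝ) • (((p + 1) * (p + 1)).map Complex.ofRealHom
      - ((p - 1) * (p - 1)).map Complex.ofRealHom) := by
    rw [← Polynomial.map_sub, show (p + 1) * (p + 1) - (p - 1) * (p - 1) = (4 : ℝ) • p by
      rw [smul_eq_C_mul, map_ofNat]; ring]
    ext k
    simp
  have h5 := LinearMap.map_smul_of_tower u (4⁻¹ : ℝ) (((p + 1) * (p + 1)).map Complex.ofRealHom
      - ((p - 1) * (p - 1)).map Complex.ofRealHom)
  rw [h4, h5, Complex.smul_im, map_sub, Complex.sub_im, him, him]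
  simp

end Complexification

/-- Stated for any set containing almost every quantile, so that it serves both the spectrum of `ψ`
and the support of the measure. -/
theorem infinite_of_forall_quantile_mem {L : ℝ[X] →ₗ[ℝ] ℝ} (hL : ∀ p : ℝ[X], p ≠ 0 → 0 < L (p * p))
    {ψ : ℝ → ℝ} (hrep : ∀ p : ℝ[X], ∫ y in Set.Ioo 0 (L 1), p.eval (quantile ψ y) = L p)
    {S : Set ℝ} (hS : ∀ᵐ y ∂volume.restrict (Set.Ioo 0 (L 1)), quantile ψ y ∈ S) :
    S.Infinite := by
  intro hfin
  set p : ℝ[X] := ∏ a ∈ hfin.toFinset, (X - C a) with hp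
  have hp0 : p ≠ 0 := Finset.prod_ne_zero_iff.2 fun a _ => X_sub_C_ne_zero a
  have h0 : ∫ y in Set.Ioo 0 (L 1), (p * p).eval (quantile ψ y) = 0 := by
    refine integral_eq_zero_of_ae ?_
    filter_upwards [hS] with y hy
    rw [eval_mul, hp, eval_prod, Finset.prod_eq_zero (hfin.mem_toFinset.2 hy) (by simp)]
    simp
  exact (hL p hp0).ne' ((hrep _).symm.trans h0)

/-- The representation theorem for positive-definite functionals. -/
theorem IsPositiveDefinite.exists_representative {u : ℂ[X] →ₗ[ℂ] ℂ} (hu : IsPositiveDefinite u) :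
    ∃ (s : ℝ) (ψ : ℝ → ℝ), IsNaturalRepresentative u ψ ∧ IsMassFunction s ψ ∧
      (∀ p : ℂ[X], IntegrableOn (fun y => p.eval (quantile ψ y : ℂ)) (Set.Ioo 0 s) ∧
        ∫ y in Set.Ioo 0 s, p.eval (quantile ψ y : ℂ) = u p) ∧
      (∀ n : ℕ, IntegrableOn (fun y => quantile ψ y ^ n) (Set.Ioo 0 s)) ∧
      ∀ S : Set ℝ, (∀ᵐ y ∂volume.restrict (Set.Ioo 0 s), quantile ψ y ∈ S) → S.Infinite := by
  obtain ⟨L, hc, hL⟩ := hu.exists_real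
  choose p hp using exists_isMonicOrthogonal hL
  choose x A hx hpx hA hG using fun n => (hp n).exists_gauss hL
  obtain ⟨φ, ψ, hφ, hlim, hψ, hrep⟩ := exists_subseq_tendsto_stepFunction hA hG
  refine ⟨L 1, ψ, ⟨_, x, A, φ, hc.isMonicOPS hL hp, fun n =>
    hc.isGaussQuadrature (hx n) (hpx n) (hA n) (hG n), hφ, hlim⟩, hψ, fun q => ?_, fun n => ?_,
    fun S => infinite_of_forall_quantile_mem hL fun q => (hrep q).2⟩
  · obtain ⟨a, b, rfl, -, -⟩ := q.exists_eq_map_add_I_mul_map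
    have ha : IntegrableOn (fun y => ((a.eval (quantile ψ y) : ℝ) : ℂ)) (Set.Ioo 0 (L 1)) :=
      (hrep a).1.ofReal
    have hb : IntegrableOn (fun y => Complex.I * ((b.eval (quantile ψ y) : ℝ) : ℂ))
        (Set.Ioo 0 (L 1)) := Integrable.const_mul (hrep b).1.ofReal _
    simp only [eval_add, eval_mul, eval_C, eval_map_ofReal]
    refine ⟨ha.add hb, ?_⟩
    rw [integral_add ha hb, integral_const_mul, ← smul_eq_C_mul, map_add, map_smul, hc, hc,
      ← (hrep a).2, ← (hrep b).2]
    simp only [integral_complex_ofReal, smul_eq_mul]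
  · simpa using (hrep (X ^ n)).1

/-! ### Favard's theorem for the three-term recurrence. -/

section Favard

/-- The monic polynomials defined by a three-term recurrence relation. -/
noncomputable def recurrencePolynomial (β γ : ℕ → ℝ) : ℕ → ℝ[X]
  | 0 => 1
  | 1 => X - C (β 0)
  | n + 2 => (X - C (β (n + 1))) * recurrencePolynomial β γ (n + 1)
      - C (γ (n + 1)) * recurrencePolynomial β γ n

variable {β γ : ℕ → ℝ}

theorem recurrencePolynomial_monic_natDegree (β γ : ℕ → ℝ) (n : ℕ) :
    (recurrencePolynomial β γ n).Monic ∧ (recurrencePolynomial β γ n).natDegree = n := by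
  induction n using Nat.twoStepInduction with
  | zero => exact ⟨monic_one, natDegree_one⟩
  | one => exact ⟨monic_X_sub_C _, natDegree_X_sub_C _⟩
  | more n ih0 ih1 =>
    have hmon := (monic_X_sub_C (β (n + 1))).mul ih1.1
    have hnat : ((X - C (β (n + 1))) * recurrencePolynomial β γ (n + 1)).natDegree = n + 2 := by
      rw [(monic_X_sub_C _).natDegree_mul ih1.1, natDegree_X_sub_C, ih1.2]
      lia
    have hlt : (C (γ (n + 1)) * recurrencePolynomial β γ n).degree
        < ((X - C (β (n + 1))) * recurrencePolynomial β γ (n + 1)).degree := by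
      rw [degree_eq_natDegree hmon.ne_zero, hnat, ← smul_eq_C_mul]
      refine (degree_smul_le _ _).trans_lt ?_
      rw [degree_eq_natDegree ih0.1.ne_zero, ih0.2]
      exact_mod_cast (by lia : n < n + 2)
    rw [recurrencePolynomial]
    exact ⟨hmon.sub_of_left hlt, by
      rw [natDegree_eq_of_degree_eq (degree_sub_eq_left_of_degree_lt hlt), hnat]⟩

theorem map_recurrencePolynomial {P : ℕ → ℂ[X]} (h0 : P 0 = 1) (h1 : P 1 = X - C (β 0 : ℂ))
    (h : ∀ n, 1 ≤ n → P (n + 1) = (X - C (β n : ℂ)) * P n - C (γ n : ℂ) * P (n - 1)) (n : ℕ) :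
    (recurrencePolynomial β γ n).map Complex.ofRealHom = P n := by
  induction n using Nat.twoStepInduction with
  | zero => simp [recurrencePolynomial, h0]
  | one => simp [recurrencePolynomial, h1]
  | more n ih0 ih1 =>
    rw [h (n + 1) (by lia), Nat.add_sub_cancel, ← ih0, ← ih1]
    simp [recurrencePolynomial]

/-- Having one polynomial in each degree, the sequence is a basis; `L` is the coordinate along its
zeroth member. -/
theorem exists_functional_recurrencePolynomial (β γ : ℕ → ℝ) :
    ∃ L : ℝ[X] →ₗ[ℝ] ℝ, ∀ n, L (recurrencePolynomial β γ n) = if n = 0 then 1 else 0 := by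
  let S : Polynomial.Sequence ℝ := ⟨recurrencePolynomial β γ, fun n => by
    obtain ⟨h1, h2⟩ := recurrencePolynomial_monic_natDegree β γ n
    rw [degree_eq_natDegree h1.ne_zero, h2]⟩
  let b := S.basis fun i => by
    rw [(recurrencePolynomial_monic_natDegree β γ i).1.leadingCoeff]; exact isUnit_one
  refine ⟨b.coord 0, fun n => ?_⟩
  have : recurrencePolynomial β γ n = b n := by simp [b, S]
  rw [this, Module.Basis.coord_apply, Module.Basis.repr_self, Finsupp.single_apply]

variable {L : ℝ[X] →ₗ[ℝ] ℝ}

theorem apply_X_pow_mul_recurrencePolynomial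
    (hL : ∀ n, L (recurrencePolynomial β γ n) = if n = 0 then 1 else 0) (k n : ℕ) (hkn : k ≤ n) :
    L (X ^ k * recurrencePolynomial β γ n) = if k = n then ∏ i ∈ Finset.Icc 1 n, γ i else 0 := by
  induction k generalizing n with
  | zero =>
    rw [pow_zero, one_mul, hL]
    rcases eq_or_ne n 0 with rfl | hn
    · simp
    · rw [if_neg hn, if_neg hn.symm]
  | succ k ih =>
    obtain ⟨m, rfl⟩ : ∃ m, n = m + 1 := ⟨n - 1, by lia⟩
    -- The recurrence solved for `X * P_{m+1}` lowers the power of `X`; by induction only the `γ`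
    -- term can contribute, and only when `k = m`.
    have hrec : X ^ (k + 1) * recurrencePolynomial β γ (m + 1)
        = X ^ k * recurrencePolynomial β γ (m + 2)
          + β (m + 1) • (X ^ k * recurrencePolynomial β γ (m + 1))
          + γ (m + 1) • (X ^ k * recurrencePolynomial β γ m) := by
      simp only [recurrencePolynomial, smul_eq_C_mul]
      ring
    rw [hrec, map_add, map_add, map_smul, map_smul, ih _ (by lia), ih _ (by lia), ih _ (by lia),
      if_neg (by lia), if_neg (by lia), smul_zero, add_zero, zero_add,
      Finset.prod_Icc_succ_top (by lia)]
    by_cases hkm : k = m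
    · rw [if_pos hkm, if_pos (by lia), smul_eq_mul, mul_comm]
    · rw [if_neg hkm, if_neg (by lia), smul_zero]

theorem apply_mul_recurrencePolynomial
    (hL : ∀ n, L (recurrencePolynomial β γ n) = if n = 0 then 1 else 0) {n : ℕ} {q : ℝ[X]}
    (hq : q.natDegree ≤ n) :
    L (q * recurrencePolynomial β γ n) = q.coeff n * ∏ i ∈ Finset.Icc 1 n, γ i := by
  conv_lhs => rw [q.as_sum_range_C_mul_X_pow' (Nat.lt_succ_of_le hq)]
  rw [Finset.sum_mul, map_sum, Finset.sum_range_succ, Finset.sum_eq_zero fun k hk => ?_, zero_add]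
  · rw [mul_assoc, ← smul_eq_C_mul, map_smul,
      apply_X_pow_mul_recurrencePolynomial hL _ _ le_rfl, if_pos rfl, smul_eq_mul]
  · have hk' := Finset.mem_range.1 hk
    rw [mul_assoc, ← smul_eq_C_mul, map_smul,
      apply_X_pow_mul_recurrencePolynomial hL _ _ hk'.le, if_neg hk'.ne, smul_zero]

theorem isMonicOrthogonal_recurrencePolynomial
    (hL : ∀ n, L (recurrencePolynomial β γ n) = if n = 0 then 1 else 0) (n : ℕ) :
    IsMonicOrthogonal L n (recurrencePolynomial β γ n) where
  monic := (recurrencePolynomial_monic_natDegree β γ n).1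
  natDegree := (recurrencePolynomial_monic_natDegree β γ n).2
  orthogonal q hq := by
    rw [mul_comm, apply_mul_recurrencePolynomial hL (natDegree_le_of_degree_le hq.le),
      coeff_eq_zero_of_degree_lt hq, zero_mul]

/-- Splitting off the leading term `c * P_n` leaves a remainder of lower degree orthogonal to `P_n`;
`L (P_n * P_n)` is a product of positive `γ`s, and induction covers the remainder. -/
theorem apply_mul_self_pos_of_recurrence (hγ : ∀ n, 1 ≤ n → 0 < γ n)
    (hL : ∀ n, L (recurrencePolynomial β γ n) = if n = 0 then 1 else 0) (p : ℝ[X]) (hp : p ≠ 0) :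
    0 < L (p * p) := by
  induction hn : p.natDegree using Nat.strong_induction_on generalizing p with
  | _ n ih =>
    have hpoly := isMonicOrthogonal_recurrencePolynomial hL n
    set e := recurrencePolynomial β γ n with he
    set c := p.leadingCoeff with hc
    have hc0 : c ≠ 0 := leadingCoeff_ne_zero.2 hp
    have hr : (p - C c * e).degree < n := by
      have := Polynomial.degree_sub_C_mul_lt hpoly.monic hpoly.natDegree (q := p)
        ((natDegree_lt_iff_degree_lt hp).1 (by lia))
      rwa [← hn, coeff_natDegree, ← hc, hn] at this
    have hee : 0 < L (e * e) := by
      rw [he, apply_mul_recurrencePolynomial hL hpoly.natDegree.le]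
      rw [hpoly.coeff_eq_one, one_mul]
      exact Finset.prod_pos fun i hi => hγ i (Finset.mem_Icc.1 hi).1
    have hrr : 0 ≤ L ((p - C c * e) * (p - C c * e)) := by
      by_cases h0 : p - C c * e = 0
      · rw [h0, mul_zero, map_zero]
      · exact (ih _ ((natDegree_lt_iff_degree_lt h0).2 hr) _ h0 rfl).le
    have hsplit : p * p = (c * c) • (e * e) + (2 * c) • (e * (p - C c * e))
        + (p - C c * e) * (p - C c * e) := by
      simp only [smul_eq_C_mul, C_mul, map_ofNat]
      ring
    rw [hsplit, map_add, map_add, map_smul, map_smul, hpoly.orthogonal _ hr, smul_zero, add_zero,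
      smul_eq_mul]
    have := mul_self_pos.2 hc0
    positivity

/-- **Favard's theorem**. -/
theorem exists_isPositiveDefinite_isMonicOPS {P : ℕ → ℂ[X]} (hγ : ∀ n, 1 ≤ n → 0 < γ n)
    (h0 : P 0 = 1) (h1 : P 1 = X - C (β 0 : ℂ))
    (h : ∀ n, 1 ≤ n → P (n + 1) = (X - C (β n : ℂ)) * P n - C (γ n : ℂ) * P (n - 1)) :
    ∃ u : ℂ[X] →ₗ[ℂ] ℂ, IsPositiveDefinite u ∧ IsMonicOPS u P ∧ u 1 = 1 ∧
      ∀ n m, u (P n * P m) = if n = m then ((∏ k ∈ Finset.Icc 1 n, γ k : ℝ) : ℂ) else 0 := by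
  obtain ⟨L, hL⟩ := exists_functional_recurrencePolynomial β γ
  have hpos := apply_mul_self_pos_of_recurrence hγ hL
  have hpoly := isMonicOrthogonal_recurrencePolynomial hL
  obtain ⟨u, hu⟩ := exists_isComplexification L
  have hP : (fun n => (recurrencePolynomial β γ n).map Complex.ofRealHom) = P :=
    funext (map_recurrencePolynomial h0 h1 h)
  have hOPS := hP ▸ hu.isMonicOPS hpos hpoly
  refine ⟨u, hu.isPositiveDefinite hpos, hOPS, ?_, fun n m => ?_⟩
  · rw [← Polynomial.map_one Complex.ofRealHom, hu, show (1 : ℝ[X]) = recurrencePolynomial β γ 0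
      from rfl, hL]
    simp
  · by_cases hnm : n = m
    · subst hnm
      rw [if_pos rfl, ← hP, ← Polynomial.map_mul, hu,
        apply_mul_recurrencePolynomial hL (hpoly n).natDegree.le, (hpoly n).coeff_eq_one, one_mul]
    · obtain ⟨-, c, -, hc⟩ := hOPS
      rw [hc, if_neg hnm, if_neg hnm]

end Favard

/-! ### The main theorem. -/

theorem mainTheorem6 :
    (∀ u : ℂ[X] →ₗ[ℂ] ℂ, IsPositiveDefinite u →
      ∃ ψ : ℝ → ℝ, IsNaturalRepresentative u ψ ∧ IsDistributionFunction ψ ∧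
        (distributionSpectrum ψ).Infinite ∧
        ∀ p : ℂ[X], HasRSIntegral (fun x : ℝ => p.eval (x : ℂ)) ψ (u p)) ∧
    (∀ (β γ : ℕ → ℝ) (P : ℕ → ℂ[X]), (∀ n, 1 ≤ n → 0 < γ n) →
      P 0 = 1 → P 1 = X - C (β 0 : ℂ) →
      (∀ n, 1 ≤ n → P (n + 1) = (X - C (β n : ℂ)) * P n - C (γ n : ℂ) * P (n - 1)) →
      ∃ μ : Measure ℝ,
        μ.support.Infinite ∧
        (∀ n : ℕ, Integrable (fun x : ℝ => |x| ^ n) μ) ∧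
        (∀ n m : ℕ, ∫ x : ℝ, (P n).eval (x : ℂ) * (P m).eval (x : ℂ) ∂μ =
          if n = m then ((∏ k ∈ Finset.Icc 1 n, γ k : ℝ) : ℂ) else 0) ∧
        ∃ (u : ℂ[X] →ₗ[ℂ] ℂ) (ψ : ℝ → ℝ),
          IsPositiveDefinite u ∧ IsMonicOPS u P ∧ u 1 = 1 ∧ IsNaturalRepresentative u ψ ∧
          ∀ x : ℝ, Tendsto ψ (𝓝[>] x) (𝓝 (μ.real (Set.Iic x)))) := by
  refine ⟨fun u hu => ?_, fun β γ P hγ h0 h1 h => ?_⟩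
  · obtain ⟨s, ψ, hnat, hψ, hrep, hmom, hinf⟩ := hu.exists_representative
    refine ⟨ψ, hnat, ⟨⟨s, fun x => abs_le.2 ⟨?_, hψ.le x⟩⟩, hψ.monotone, fun n => ⟨_,
      hψ.hasRSIntegral (continuous_pow n) (hmom n)⟩⟩, hinf _ ?_, fun p => ?_⟩
    · linarith [hψ.nonneg x, hψ.le x]
    · filter_upwards [ae_restrict_mem measurableSet_Ioo] with y hy
      exact hψ.quantile_mem_spectrum hy
    · rw [← (hrep p).2]
      exact hψ.hasRSIntegral (f := fun x : ℝ => p.eval (x : ℂ))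
        (p.continuous.comp Complex.continuous_ofReal) (hrep p).1
  · obtain ⟨u, hu, hOPS, hone, horth⟩ := exists_isPositiveDefinite_isMonicOPS hγ h0 h1 h
    obtain ⟨s, ψ, hnat, hψ, hrep, hmom, hinf⟩ := hu.exists_representative
    refine ⟨quantileMeasure s ψ, hinf _ ?_, fun n => ?_, fun n m => ?_, u, ψ, hu, hOPS, hone, hnat,
      hψ.tendsto_nhdsGT⟩
    -- A measure is carried by its support, so almost every quantile lies in it.
    · exact ae_of_ae_map hψ.aemeasurable_quantile Measure.support_mem_ae
    · have hc : Continuous fun x : ℝ => |x| ^ n := by fun_prop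
      refine (integrable_map_measure hc.aestronglyMeasurable hψ.aemeasurable_quantile).2 ?_
      simpa [Function.comp_def] using (hmom n).norm
    · rw [← horth, ← (hrep (P n * P m)).2, ← hψ.integral_quantileMeasure
        (f := fun x : ℝ => (P n * P m).eval (x : ℂ))
        ((P n * P m).continuous.comp Complex.continuous_ofReal)]
      simp only [eval_mul]
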